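/- Let $d\ge 3$ and let $P$ be a simplicial $d$-polytope, that is, the $d$-dimensional convex hull of a finite set of points in some $\mathbb{R}^n$, all of whose facets are simplices (polytopes whose face lattice is isomorphic to that of a simplex). Let $G(P)$ be the graph formed by the vertices and edges of $P$, and let $\delta$ be the minimum degree of $G(P)$. Then $G(P)$ is $\min\{\delta,4d-6\}$-edge-connected. Here a graph is $r$-edge-connected if no two distinct vertices are separated by fewer than $r$ edges, i.e. after the removal of any set of fewer than $r$ edges any two vertices are still joined by a path. -/

import Mathlib

/-- The dimension of a set in a real vector space, that is, the dimension of its affine hull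
(one less than the maximum number of affinely independent points), with value `-1` for `∅`. -/
noncomputable def affineDim {V : Type*} [AddCommGroup V] [Module ℝ V] (A : Set V) : ℤ :=
  open Classical in
  if A.Nonempty then (Module.finrank ℝ (vectorSpan ℝ A) : ℤ) else -1

/-- The face lattice of a polytope `A`, ordered by inclusion. In Mathlib, `IsExposed ℝ A F` says
that `F` is empty or the set of maximizers on `A` of a linear functional `l`. For `l = 0` this is
`A` itself, and for `l ≠ 0` it is the intersection of `A` with a supporting hyperplane, so for a
polytope the exposed sets are exactly the faces (with the empty face and the polytope itself). -/
abbrev FaceLattice {V : Type*} [AddCommGroup V] [Module ℝ V] [TopologicalSpace V]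
    (A : Set V) : Type _ :=
  {F : Set V // IsExposed ℝ A F}

/-- Two polytopes are combinatorially isomorphic if their face lattices are isomorphic. -/
def CombIso {V W : Type*} [AddCommGroup V] [Module ℝ V] [TopologicalSpace V]
    [AddCommGroup W] [Module ℝ W] [TopologicalSpace W] (A : Set V) (B : Set W) : Prop :=
  Nonempty (FaceLattice A ≃o FaceLattice B)

/-- A simplex is a polytope that is combinatorially isomorphic to a standard simplex (the convex
hull of the standard basis vectors of some `ℝ^k`). -/
def IsCombSimplex {V : Type*} [AddCommGroup V] [Module ℝ V] [TopologicalSpace V]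
    (A : Set V) : Prop :=
  ∃ k : ℕ, CombIso A (stdSimplex ℝ (Fin k))

/-- A convex polytope in `ℝ^n`: the convex hull of a finite set of points. -/
structure ConvexPolytope (n : ℕ) where
  carrier : Set (EuclideanSpace ℝ (Fin n))
  exists_finite_hull : ∃ s : Set (EuclideanSpace ℝ (Fin n)), s.Finite ∧ carrier = convexHull ℝ s

namespace ConvexPolytope

variable {n : ℕ}

/-- The dimension of a polytope. -/
noncomputable def dim (P : ConvexPolytope n) : ℤ := affineDim P.carrier

/-- A facet is a face whose dimension is one less than that of the polytope. -/
def IsFacet (P : ConvexPolytope n) (F : Set (EuclideanSpace ℝ (Fin n))) : Prop :=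
  IsExposed ℝ P.carrier F ∧ affineDim F = P.dim - 1

/-- A polytope is simplicial if all its facets are simplices. -/
def IsSimplicial (P : ConvexPolytope n) : Prop :=
  ∀ F, P.IsFacet F → IsCombSimplex F

/-- The vertices of a polytope: the points `v` such that `{v}` is a face. -/
abbrev Vertex (P : ConvexPolytope n) : Type :=
  {v : EuclideanSpace ℝ (Fin n) // IsExposed ℝ P.carrier {v}}

/-- A polytope has finitely many vertices. -/
theorem finite_vertex (P : ConvexPolytope n) : Finite P.Vertex := by
  obtain ⟨s, hs, hP⟩ := P.exists_finite_hull
  refine (hs.subset ?_ : Set.Finite {v | IsExposed ℝ P.carrier {v}}).to_subtype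
  intro v hv
  have h1 : v ∈ P.carrier.extremePoints ℝ :=
    exposedPoints_subset_extremePoints (mem_exposedPoints_iff_exposed_singleton.2 hv)
  rw [hP] at h1
  exact extremePoints_convexHull_subset h1

noncomputable instance (P : ConvexPolytope n) : Fintype P.Vertex :=
  have := P.finite_vertex
  Fintype.ofFinite _

/-- The graph of a polytope: distinct vertices `u`, `v` are adjacent if the segment `[u, v]` is a
face, that is, an edge (every one-dimensional face is the segment joining its two vertices). -/
def graph (P : ConvexPolytope n) : SimpleGraph P.Vertex where
  Adj u v := u ≠ v ∧ IsExposed ℝ P.carrier (segment ℝ u.1 v.1)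
  symm := ⟨fun u v h => ⟨h.1.symm, segment_symm ℝ u.1 v.1 ▸ h.2⟩⟩
  loopless := ⟨fun _ h => h.1 rfl⟩

/-- The minimum degree of the graph of a polytope. -/
noncomputable def minDegree (P : ConvexPolytope n) : ℕ :=
  open Classical in P.graph.minDegree

end ConvexPolytope

/-!
An edge cut with fewer than `min δ (4d - 6)` edges is excluded by counting the edges at its ends.

Let `X` be one side of the cut. A nonempty vertex set with at most `δ` elements has at least `δ`
edges leaving it, so both sides have more than `δ ≥ d` vertices. By Balinski's theorem
(`ConvexPolytope.balinski`) fewer than `d` vertices cannot cover all cut edges, as removing them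
would separate what remains of the two sides. By Kőnig's theorem there are `d` disjoint cut edges.

In a simplicial `d`-polytope the ends of every edge `xy` have at least `d - 1` common neighbors
(`ConvexPolytope.le_card_common_neighbors`): the edge lies in two facets with different vertices,
and the vertices of a facet are pairwise adjacent. Each common neighbor of the ends of a cut edge
`xy` is joined by a cut edge to `x` or to `y`, so at least `d + 1` ends of cut edges are at `x`
or `y`. Summing over the `d` disjoint cut edges, there are at least `d (d + 1) / 2 ≥ 4d - 6` cut
edges (`SimpleGraph.isEdgeConnected_of_common_neighbors`).

The geometric input is elementary polytope theory, obtained from the description of faces of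
`convexHull ℝ V` as hulls of the maximizers in `V` of a linear functional: the pivot step of the
simplex method (`exists_increasing_edge`), from which Balinski's theorem follows, and the existence
of a facet that contains a given face and misses a given vertex (`exists_facet_avoiding`). That the
vertices of a facet are pairwise adjacent is read off from its face lattice, in which any two atoms
lie below an element with no other atoms below it.
-/

/-! ### Faces of the convex hull of a finite set -/

section Faces

variable {E : Type*} [NormedAddCommGroup E] [NormedSpace ℝ E]

/-- A convex combination at which `l` attains its bound involves only points at which it does. -/
theorem mem_convexHull_top {V : Set E} {l : StrongDual ℝ E} {c : ℝ} (hV : ∀ v ∈ V, l v ≤ c)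
    {x : E} (hx : x ∈ convexHull ℝ V) (hc : l x = c) : x ∈ convexHull ℝ {v ∈ V | l v = c} := by
  let S : Set E := {x | l x ≤ c ∧ (l x = c → x ∈ convexHull ℝ {v ∈ V | l v = c})}
  have hS : Convex ℝ S := by
    refine convex_iff_forall_pos.2 fun x hx y hy a b ha hb hab => ?_
    have hxa : a * l x ≤ a * c := mul_le_mul_of_nonneg_left hx.1 ha.le
    have hyb : b * l y ≤ b * c := mul_le_mul_of_nonneg_left hy.1 hb.le
    have hsum : a * c + b * c = c := by rw [← add_mul, hab, one_mul]
    have hl : l (a • x + b • y) = a * l x + b * l y := by simp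
    refine ⟨by rw [hl]; linarith, fun h => ?_⟩
    rw [hl] at h
    have h1 : l x = c := mul_left_cancel₀ ha.ne' (by linarith)
    have h2 : l y = c := mul_left_cancel₀ hb.ne' (by linarith)
    exact convex_convexHull ℝ _ (hx.2 h1) (hy.2 h2) ha.le hb.le hab
  have hVS : V ⊆ S := fun v hv => ⟨hV v hv, fun h => subset_convexHull ℝ _ ⟨hv, h⟩⟩
  exact (convexHull_min hVS hS hx).2 hc

theorem le_of_mem_convexHull {V : Set E} {l : StrongDual ℝ E} {c : ℝ} (hV : ∀ v ∈ V, l v ≤ c)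
    {x : E} (hx : x ∈ convexHull ℝ V) : l x ≤ c :=
  convexHull_min (t := {x | l x ≤ c}) hV (convex_halfSpace_le l.toLinearMap.isLinear c) hx

theorem eq_of_mem_convexHull {V : Set E} {l : StrongDual ℝ E} {c : ℝ} (hV : ∀ v ∈ V, l v = c)
    {x : E} (hx : x ∈ convexHull ℝ V) : l x = c :=
  convexHull_min (t := {x | l x = c}) hV (convex_hyperplane l.toLinearMap.isLinear c) hx

/-- The nonempty faces of a convex hull are the hulls of the points at which a linear functional
attains an upper bound `c`. -/
theorem isExposed_convexHull_iff {V F : Set E} (hF : F.Nonempty) :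
    IsExposed ℝ (convexHull ℝ V) F ↔ ∃ (l : StrongDual ℝ E) (c : ℝ),
      (∀ v ∈ V, l v ≤ c) ∧ F = convexHull ℝ {v ∈ V | l v = c} := by
  constructor
  · intro h
    obtain ⟨l, hl⟩ := h hF
    obtain ⟨x, hx⟩ := hF
    have hx' : x ∈ convexHull ℝ V ∧ ∀ y ∈ convexHull ℝ V, l y ≤ l x := by rwa [hl] at hx
    have hV : ∀ v ∈ V, l v ≤ l x := fun v hv => hx'.2 v (subset_convexHull ℝ _ hv)
    refine ⟨l, l x, hV, ?_⟩
    rw [hl]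
    ext y
    constructor
    · rintro ⟨hy, hy'⟩
      exact mem_convexHull_top hV hy (le_antisymm (hx'.2 y hy) (hy' x hx'.1))
    · intro hy
      refine ⟨convexHull_mono (Set.sep_subset _ _) hy, fun z hz => ?_⟩
      rw [eq_of_mem_convexHull (fun v hv => hv.2) hy]
      exact hx'.2 z hz
  · rintro ⟨l, c, hV, rfl⟩ _
    refine ⟨l, ?_⟩
    obtain ⟨x, hx⟩ := hF
    ext y
    constructor
    · intro hy
      refine ⟨convexHull_mono (Set.sep_subset _ _) hy, fun z hz => ?_⟩
      rw [eq_of_mem_convexHull (fun v hv => hv.2) hy]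
      exact le_of_mem_convexHull hV hz
    · rintro ⟨hy, hy'⟩
      refine mem_convexHull_top hV hy (le_antisymm (le_of_mem_convexHull hV hy) ?_)
      rw [← eq_of_mem_convexHull (fun v hv => hv.2) hx]
      exact hy' x (convexHull_mono (Set.sep_subset _ _) hx)

/-- A small perturbation `k + ε l` orders a finite set lexicographically by `k`, then `l`. -/
theorem exists_perturbation {V : Set E} (hV : V.Finite) (k l : StrongDual ℝ E) :
    ∃ ε : ℝ, 0 < ε ∧ ∀ x ∈ V, ∀ y ∈ V, k x < k y → (k + ε • l) x < (k + ε • l) y := by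
  have h : ∀ᶠ ε in nhdsWithin (0 : ℝ) (Set.Ioi 0),
      ∀ x ∈ V, ∀ y ∈ V, k x < k y → (k + ε • l) x < (k + ε • l) y := by
    refine (Filter.eventually_all_finite hV).2 fun x _ =>
      (Filter.eventually_all_finite hV).2 fun y _ => ?_
    by_cases hxy : k x < k y
    · have hc : Continuous fun ε : ℝ => (k + ε • l) y - (k + ε • l) x := by
        simp only [add_apply, smul_apply]
        fun_prop
      have h0 : (0 : ℝ) < (k + (0 : ℝ) • l) y - (k + (0 : ℝ) • l) x := by simpa using hxy
      have := (hc.tendsto 0).eventually (lt_mem_nhds h0)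
      filter_upwards [nhdsWithin_le_nhds this] with ε hε _
      exact sub_pos.1 hε
    · exact Filter.Eventually.of_forall fun _ h => absurd h hxy
  obtain ⟨ε, h1, h2⟩ := (h.and self_mem_nhdsWithin).exists
  exact ⟨ε, h2, h1⟩

/-- For polytopes, unlike for general convex sets, a face of a face is a face. -/
theorem IsExposed.trans_convexHull {V F G : Set E} (hV : V.Finite)
    (hF : IsExposed ℝ (convexHull ℝ V) F) (hG : IsExposed ℝ F G) :
    IsExposed ℝ (convexHull ℝ V) G := by
  rcases G.eq_empty_or_nonempty with rfl | hGn
  · exact isExposed_empty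
  obtain ⟨k, c, hk, rfl⟩ := (isExposed_convexHull_iff (hGn.mono hG.subset)).1 hF
  obtain ⟨l, b, hl, rfl⟩ := (isExposed_convexHull_iff hGn).1 hG
  obtain ⟨ε, hε, hlex⟩ := exists_perturbation hV k l
  obtain ⟨v₀, ⟨hv₀V, hv₀k⟩, hv₀l⟩ := convexHull_nonempty_iff.1 hGn
  have hval : (k + ε • l) v₀ = c + ε * b := by simp [hv₀k, hv₀l]
  refine (isExposed_convexHull_iff hGn).2 ⟨k + ε • l, c + ε * b, fun v hv => ?_, ?_⟩
  · rcases (hk v hv).lt_or_eq with h | h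
    · rw [← hval]
      exact (hlex v hv v₀ hv₀V (by rwa [hv₀k])).le
    · have := mul_le_mul_of_nonneg_left (hl v ⟨hv, h⟩) hε.le
      simp [h, this]
  · congr 1
    ext v
    constructor
    · rintro ⟨⟨hv, hvk⟩, hvl⟩
      exact ⟨hv, by simp [hvk, hvl]⟩
    · rintro ⟨hv, h⟩
      have hvk : k v = c := by
        by_contra hne
        have := hlex v hv v₀ hv₀V (by rw [hv₀k]; exact lt_of_le_of_ne (hk v hv) hne)
        rw [h, hval] at this
        exact this.false
      refine ⟨⟨hv, hvk⟩, ?_⟩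
      have : c + ε * l v = c + ε * b := by simpa [hvk] using h
      exact mul_left_cancel₀ hε.ne' (by linarith)

theorem exists_strict_of_isExposed_singleton {A : Set E} {v : E} (h : IsExposed ℝ A {v}) :
    ∃ l : StrongDual ℝ E, ∀ w ∈ A, w ≠ v → l w < l v := by
  obtain ⟨l, hl⟩ := h (Set.singleton_nonempty v)
  refine ⟨l, fun w hw hne => ?_⟩
  have hv : v ∈ {x ∈ A | ∀ y ∈ A, l y ≤ l x} := hl ▸ Set.mem_singleton v
  refine lt_of_le_of_ne (hv.2 w hw) fun heq => hne ?_
  have : w ∈ ({v} : Set E) := by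
    rw [hl]
    exact ⟨hw, fun y hy => heq ▸ hv.2 y hy⟩
  exact this

theorem isExposed_singleton_of_strict {V : Set E} {v : E} (hv : v ∈ V) {l : StrongDual ℝ E}
    (h : ∀ w ∈ V, w ≠ v → l w < l v) : IsExposed ℝ (convexHull ℝ V) {v} := by
  refine (isExposed_convexHull_iff (Set.singleton_nonempty v)).2 ⟨l, l v, fun w hw => ?_, ?_⟩
  · rcases eq_or_ne w v with rfl | hne
    · exact le_rfl
    · exact (h w hw hne).le
  · have : {w ∈ V | l w = l v} = {v} := by
      ext w
      refine ⟨fun hw => by_contra fun hne => (h w hw.1 hne).ne hw.2, ?_⟩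
      rintro rfl
      exact ⟨hv, rfl⟩
    rw [this, convexHull_singleton]

theorem exposedPoints_convexHull_subset (s : Set E) :
    (convexHull ℝ s).exposedPoints ℝ ⊆ s :=
  exposedPoints_subset_extremePoints.trans extremePoints_convexHull_subset

/-- A polytope is the convex hull of its vertices. The exposed points are found in a generating set
of minimal size, each member of which can be separated from the hull of the others. -/
theorem convexHull_exposedPoints_convexHull {s : Set E} (hs : s.Finite) :
    convexHull ℝ ((convexHull ℝ s).exposedPoints ℝ) = convexHull ℝ s := by
  induction hn : s.ncard using Nat.strong_induction_on generalizing s with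
  | _ n ih =>
  subst hn
  by_cases h : ∃ v ∈ s, v ∈ convexHull ℝ (s \ {v})
  · obtain ⟨v, hv, hv'⟩ := h
    have heq : convexHull ℝ (s \ {v}) = convexHull ℝ s := by
      refine (convexHull_mono Set.sdiff_subset).antisymm (convexHull_min ?_ (convex_convexHull ℝ _))
      intro w hw
      rcases eq_or_ne w v with rfl | hne
      · exact hv'
      · exact subset_convexHull ℝ _ ⟨hw, hne⟩
    have := ih _ (Set.ncard_sdiff_singleton_lt_of_mem hv hs) (hs.subset Set.sdiff_subset) rfl
    rwa [heq] at this
  · push Not at h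
    refine (convexHull_min ?_ (convex_convexHull ℝ _)).antisymm (convexHull_mono ?_)
    · exact exposedPoints_subset
    · intro v hv
      rw [mem_exposedPoints_iff_exposed_singleton]
      obtain ⟨l, u, h1, h2⟩ := geometric_hahn_banach_closed_point (convex_convexHull ℝ (s \ {v}))
        (Set.Finite.isClosed_convexHull ℝ (hs.subset Set.sdiff_subset)) (h v hv)
      exact isExposed_singleton_of_strict hv (l := l) fun w hw hne =>
        (h1 w (subset_convexHull ℝ _ ⟨hw, hne⟩)).trans h2

end Faces

/-! ### Increasing edges and facets -/

section EdgesFacets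

variable {E : Type*} [NormedAddCommGroup E] [NormedSpace ℝ E]

/-- The pivot step of the simplex method: a vertex `v` that does not maximize `f` lies on an edge
along which `f` increases. The edges at `v` correspond to the vertices of the vertex figure, which
is obtained by rescaling the directions `u - v` into a common hyperplane; as that polytope is the
hull of its vertices, one of them has positive `f`-value. -/
theorem exists_increasing_edge {V : Set E} (hV : V.Finite) {v : E} (hv : v ∈ V)
    {l : StrongDual ℝ E} (hl : ∀ u ∈ V, u ≠ v → l u < l v) (f : StrongDual ℝ E)
    {w₀ : E} (hw₀ : w₀ ∈ V) (hf : f v < f w₀) :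
    ∃ w ∈ V, w ≠ v ∧ f v < f w ∧ IsExposed ℝ (convexHull ℝ V) (segment ℝ v w) := by
  have hpos : ∀ u ∈ V, u ≠ v → 0 < l v - l u := fun u hu hne => sub_pos.2 (hl u hu hne)
  let p : E → E := fun u => (l v - l u)⁻¹ • (u - v)
  let Q : Set E := p '' (V \ {v})
  have hQ : Q.Finite := (hV.subset Set.sdiff_subset).image p
  have hp : ∀ u ∈ V, u ≠ v → u - v = (l v - l u) • p u := fun u hu hne => by
    simp only [p]
    rw [smul_inv_smul₀ (hpos u hu hne).ne']
  obtain ⟨q, hq, hfq⟩ : ∃ q ∈ (convexHull ℝ Q).exposedPoints ℝ, 0 < f q := by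
    by_contra! hcon
    have hw₀v : w₀ ≠ v := by
      rintro rfl
      exact hf.false
    have h1 : p w₀ ∈ convexHull ℝ Q := subset_convexHull ℝ _ ⟨w₀, ⟨hw₀, hw₀v⟩, rfl⟩
    rw [← convexHull_exposedPoints_convexHull hQ] at h1
    have h2 := le_of_mem_convexHull hcon h1
    have h3 : f w₀ - f v = (l v - l w₀) * f (p w₀) := by
      rw [← map_sub, hp w₀ hw₀ hw₀v, map_smul, smul_eq_mul]
    nlinarith [hpos w₀ hw₀ hw₀v]
  obtain ⟨g, hg⟩ := exists_strict_of_isExposed_singleton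
    (mem_exposedPoints_iff_exposed_singleton.1 hq)
  -- `k` supports the hull of `V` in the vertices on the ray from `v` in direction `q`.
  let k : StrongDual ℝ E := g + (g q) • l
  have hk : ∀ u ∈ V, u ≠ v → k u - k v = (l v - l u) * (g (p u) - g q) := fun u hu hne => by
    have h3 : g u - g v = (l v - l u) * g (p u) := by
      rw [← map_sub, hp u hu hne, map_smul, smul_eq_mul]
    simp only [k, add_apply, smul_apply, smul_eq_mul]
    linear_combination h3
  have hQp : ∀ u ∈ V, u ≠ v → p u ∈ convexHull ℝ Q := fun u hu hne =>
    subset_convexHull ℝ _ ⟨u, ⟨hu, hne⟩, rfl⟩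
  have hkle : ∀ u ∈ V, k u ≤ k v := fun u hu => by
    rcases eq_or_ne u v with rfl | hne
    · exact le_rfl
    have h4 : g (p u) ≤ g q := by
      rcases eq_or_ne (p u) q with h | h
      · rw [h]
      · exact (hg _ (hQp u hu hne) h).le
    nlinarith [hk u hu hne, hpos u hu hne]
  have hkeq : ∀ u ∈ V, u ≠ v → k u = k v → p u = q := fun u hu hne h => by
    by_contra hpq
    have := hg _ (hQp u hu hne) hpq
    nlinarith [hk u hu hne, hpos u hu hne]
  let R : Set E := {u ∈ V | u ≠ v ∧ p u = q}
  obtain ⟨u₀, ⟨hu₀, hu₀v⟩, hu₀q⟩ : q ∈ Q := exposedPoints_convexHull_subset Q hq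
  obtain ⟨w, ⟨hwV, hwv, hwq⟩, hwmin⟩ := Set.exists_min_image R l (hV.subset (Set.sep_subset _ _))
    ⟨u₀, hu₀, hu₀v, hu₀q⟩
  have hwpos := hpos w hwV hwv
  have hwdir : w - v = (l v - l w) • q := by rw [hp w hwV hwv, hwq]
  refine ⟨w, hwV, hwv, ?_, ?_⟩
  · have : f w - f v = (l v - l w) * f q := by
      rw [← map_sub, hwdir, map_smul, smul_eq_mul]
    nlinarith [mul_pos hwpos hfq]
  · refine (isExposed_convexHull_iff ⟨v, left_mem_segment ℝ v w⟩).2 ⟨k, k v, hkle, ?_⟩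
    refine Set.Subset.antisymm ?_ (convexHull_min ?_ (convex_segment v w))
    · rw [← convexHull_pair]
      refine convexHull_mono ?_
      rintro x (rfl | rfl)
      · exact ⟨hv, rfl⟩
      · refine ⟨hwV, ?_⟩
        have := hk x hwV hwv
        rw [hwq, sub_self, mul_zero] at this
        exact sub_eq_zero.1 this
    · rintro u ⟨hu, huk⟩
      rcases eq_or_ne u v with rfl | hne
      · exact left_mem_segment ℝ _ _
      have huq := hkeq u hu hne huk
      have hupos := hpos u hu hne
      have hle : l w ≤ l u := hwmin u ⟨hu, hne, huq⟩
      rw [segment_eq_image']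
      refine ⟨(l v - l u) / (l v - l w), ⟨by positivity, ?_⟩, ?_⟩
      · rw [div_le_one hwpos]
        linarith
      · have h5 : (l v - l u) / (l v - l w) * (l v - l w) = l v - l u :=
          div_mul_cancel₀ _ hwpos.ne'
        simp only
        rw [hwdir, smul_smul, h5, ← huq, ← hp u hu hne]
        abel

theorem vectorSpan_convexHull (V : Set E) :
    vectorSpan ℝ (convexHull ℝ V) = vectorSpan ℝ V := by
  rw [← direction_affineSpan, affineSpan_convexHull, direction_affineSpan]

/-- A functional vanishing on differences of `V` is constant on `V`. -/
theorem vectorSpan_le_ker_iff {V : Set E} {x : E} (hx : x ∈ V) (g : StrongDual ℝ E) :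
    vectorSpan ℝ V ≤ LinearMap.ker g.toLinearMap ↔ ∀ v ∈ V, g v = g x := by
  rw [vectorSpan_eq_span_vsub_set_right ℝ hx, Submodule.span_le]
  constructor
  · intro h v hv
    have : v -ᵥ x ∈ LinearMap.ker g.toLinearMap := h ⟨v, hv, rfl⟩
    simpa [sub_eq_zero] using this
  · rintro h _ ⟨v, hv, rfl⟩
    simp [h v hv]

theorem exists_dual_of_notMem [FiniteDimensional ℝ E] {U : Submodule ℝ E} {w : E} (hw : w ∉ U) :
    ∃ g : StrongDual ℝ E, U ≤ LinearMap.ker g.toLinearMap ∧ g w ≠ 0 := by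
  obtain ⟨g, h1, h2⟩ := Submodule.exists_le_ker_of_notMem hw
  exact ⟨LinearMap.toContinuousLinearMap g, h2, h1⟩

/-- Every face that misses a vertex `z` is contained in a facet that misses `z`. Among the faces
between the given one and `z`, one with the most vertices is a facet: if its codimension were at
least two, its supporting hyperplane could be rotated about it in both directions until it hits
further vertices, and `z` would be hit in at most one of the two directions. -/
theorem exists_facet_avoiding [FiniteDimensional ℝ E] {V : Set E} (hV : V.Finite) {x z : E}
    (hx : x ∈ V) (hz : z ∈ V) {l₀ : StrongDual ℝ E} (hl₀ : ∀ v ∈ V, l₀ v ≤ l₀ x)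
    (hz₀ : l₀ z < l₀ x) :
    ∃ l : StrongDual ℝ E, (∀ v ∈ V, l v ≤ l x) ∧ (∀ v ∈ V, l₀ v = l₀ x → l v = l x) ∧ l z < l x ∧
      Module.finrank ℝ (vectorSpan ℝ {v ∈ V | l v = l x}) + 1 =
        Module.finrank ℝ (vectorSpan ℝ V) := by
  let T : StrongDual ℝ E → Set E := fun l => {v ∈ V | l v = l x}
  let good : StrongDual ℝ E → Prop := fun l =>
    (∀ v ∈ V, l v ≤ l x) ∧ (∀ v ∈ V, l₀ v = l₀ x → l v = l x) ∧ l z < l x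
  have hT : ∀ l, (T l).Finite := fun l => hV.subset (Set.sep_subset _ _)
  obtain ⟨l, hl, hmax⟩ : ∃ l, good l ∧ ∀ l', good l' → (T l').ncard ≤ (T l).ncard := by
    let A : Set ℕ := (fun l => (T l).ncard) '' {l | good l}
    have hA : A.Nonempty := ⟨_, l₀, ⟨hl₀, fun _ _ h => h, hz₀⟩, rfl⟩
    have hb : BddAbove A := by
      refine ⟨V.ncard, ?_⟩
      rintro _ ⟨l, _, rfl⟩
      exact Set.ncard_le_ncard (Set.sep_subset _ _) hV
    obtain ⟨l, hl, hlA⟩ := Nat.sSup_mem hA hb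
    refine ⟨l, hl, fun l' hl' => ?_⟩
    have := le_csSup hb ⟨l', hl', rfl⟩
    exact this.trans hlA.ge
  refine ⟨l, hl.1, hl.2.1, hl.2.2, ?_⟩
  obtain ⟨hl1, hl2, hl3⟩ := hl
  change Module.finrank ℝ (vectorSpan ℝ (T l)) + 1 = _
  set U := vectorSpan ℝ (T l) with hU
  set W := vectorSpan ℝ V with hW
  have hxT : x ∈ T l := ⟨hx, rfl⟩
  have hUW : U ≤ W := vectorSpan_mono ℝ (Set.sep_subset _ _)
  have hUl : U ≤ LinearMap.ker l.toLinearMap := (vectorSpan_le_ker_iff hxT l).2 fun v hv => hv.2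
  -- `K` is the direction of the supporting hyperplane inside the affine hull of `V`.
  let K : Submodule ℝ E := W ⊓ LinearMap.ker l.toLinearMap
  have hWl : ¬ W ≤ LinearMap.ker l.toLinearMap := fun h =>
    hl3.ne ((vectorSpan_le_ker_iff hx l).1 h z hz)
  have hK : Module.finrank ℝ K + 1 = Module.finrank ℝ W := by
    have h1 := LinearMap.finrank_range_add_finrank_ker (l.toLinearMap.domRestrict W)
    have h2 : LinearMap.range (l.toLinearMap.domRestrict W) = ⊤ := by
      refine LinearMap.range_eq_top.2 (LinearMap.surjective fun h0 => hWl fun w hw => ?_)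
      exact LinearMap.congr_fun h0 ⟨w, hw⟩
    have h3 : Module.finrank ℝ (LinearMap.ker (l.toLinearMap.domRestrict W)) =
        Module.finrank ℝ K := by
      rw [LinearEquiv.finrank_eq (Submodule.equivMapOfInjective W.subtype W.injective_subtype
        (LinearMap.ker (l.toLinearMap.domRestrict W))),
        LinearMap.ker_domRestrict, Submodule.map_comap_subtype]
    rw [h2, h3, finrank_top, Module.finrank_self] at h1
    omega
  suffices hUK : U = K by rw [hUK, hK]
  by_contra hne
  have hUK : U ≤ K := le_inf hUW hUl
  obtain ⟨w, hwK, hwU⟩ := SetLike.exists_of_lt (lt_of_le_of_ne hUK hne)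
  obtain ⟨g, hgU, hgw⟩ := exists_dual_of_notMem hwU
  have hgT : ∀ v ∈ T l, g v = g x := (vectorSpan_le_ker_iff hxT g).1 hgU
  let h : E → ℝ := fun v => l x - l v
  have hh : ∀ v ∈ V, v ∉ T l → 0 < h v := fun v hv hvT =>
    sub_pos.2 (lt_of_le_of_ne (hl1 v hv) fun he => hvT ⟨hv, he⟩)
  let s : E → ℝ := fun v => (g v - g x) / h v
  have hs : ∀ v ∈ V, v ∉ T l → g v - g x = s v * h v := fun v hv hvT =>
    (div_mul_cancel₀ _ (hh v hv hvT).ne').symm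
  have hzT : z ∉ T l := fun hzT => hl3.ne hzT.2
  have hfin : (V \ T l).Finite := hV.subset Set.sdiff_subset
  obtain ⟨a, ⟨haV, haT⟩, ha⟩ := Set.exists_max_image (V \ T l) s hfin ⟨z, hz, hzT⟩
  obtain ⟨b, ⟨hbV, hbT⟩, hb⟩ := Set.exists_min_image (V \ T l) s hfin ⟨z, hz, hzT⟩
  -- The two extreme slopes differ, since otherwise `g` would be a multiple of `l` on `V`.
  have hab : s b < s a := by
    by_contra hcon
    have hconst : ∀ v ∈ V, (g + s a • l) v = (g + s a • l) x := fun v hv => by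
      simp only [add_apply, smul_apply, smul_eq_mul]
      by_cases hvT : v ∈ T l
      · rw [hgT v hvT, hvT.2]
      · have h1 := ha v ⟨hv, hvT⟩
        have h2 := hb v ⟨hv, hvT⟩
        have h3 : s v = s a := by linarith
        have h4 := hs v hv hvT
        rw [h3] at h4
        simp only [h] at h4
        linear_combination h4
    have hker := (vectorSpan_le_ker_iff hx _).2 hconst hwK.1
    have hlw : l w = 0 := hwK.2
    have : g w + s a * l w = 0 := by simpa using hker
    rw [hlw, mul_zero, add_zero] at this
    exact hgw this
  -- Rotating until an extreme slope `s c` is hit (`σ` is the sense of rotation) gives a strictly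
  -- larger face; by maximality it contains `z`, that is, `z` has the same slope.
  have key : ∀ (σ : ℝ) (c : E), c ∈ V → c ∉ T l →
      (∀ v ∈ V, v ∉ T l → σ * s v ≤ σ * s c) → σ * s z = σ * s c := by
    intro σ c hcV hcT hc
    by_contra hzc
    let l' : StrongDual ℝ E := σ • g + (σ * s c) • l
    have hl' : ∀ v ∈ V, v ∉ T l → l' v - l' x = h v * (σ * s v - σ * s c) := fun v hv hvT => by
      have h4 := hs v hv hvT
      simp only [l', h, add_apply, smul_apply, smul_eq_mul] at h4 ⊢
      linear_combination σ * h4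
    have hl'T : ∀ v ∈ T l, l' v = l' x := fun v hv => by
      simp only [l', add_apply, smul_apply]
      rw [hgT v hv, hv.2]
    have hgood : good l' := by
      refine ⟨fun v hv => ?_, fun v hv he => hl'T v ⟨hv, hl2 v hv he⟩, ?_⟩
      · by_cases hvT : v ∈ T l
        · exact (hl'T v hvT).le
        · nlinarith [hl' v hv hvT, hc v hv hvT, hh v hv hvT]
      · have h5 := lt_of_le_of_ne (hc z hz hzT) hzc
        nlinarith [hl' z hz hzT, hh z hz hzT]
    have hcl' : c ∈ T l' := ⟨hcV, by
      have := hl' c hcV hcT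
      rw [sub_self, mul_zero] at this
      exact sub_eq_zero.1 this⟩
    have hlt : (T l).ncard < (T l').ncard := by
      refine Set.ncard_lt_ncard ⟨fun v hv => ⟨hv.1, hl'T v hv⟩, fun hsub => hcT (hsub hcl')⟩ (hT l')
    exact absurd (hmax l' hgood) (by omega)
  have h1 := key 1 a haV haT fun v hv hvT => by simpa using ha v ⟨hv, hvT⟩
  have h2 := key (-1) b hbV hbT fun v hv hvT => by simpa using hb v ⟨hv, hvT⟩
  linarith

end EdgesFacets

/-! ### Combinatorial simplices -/

section CombSimplex

variable {E : Type*} [AddCommGroup E] [Module ℝ E] [TopologicalSpace E]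

instance (A : Set E) : OrderBot (FaceLattice A) where
  bot := ⟨∅, isExposed_empty⟩
  bot_le F := Set.empty_subset F.1

theorem FaceLattice.ne_bot_iff {A : Set E} {F : FaceLattice A} : F ≠ ⊥ ↔ F.1.Nonempty := by
  rw [Set.nonempty_iff_ne_empty, ne_eq, ne_eq, ← Subtype.coe_inj]
  rfl

theorem isAtom_singleton {A : Set E} {a : E} (h : IsExposed ℝ A {a}) :
    IsAtom (⟨{a}, h⟩ : FaceLattice A) := by
  refine ⟨FaceLattice.ne_bot_iff.2 (Set.singleton_nonempty a), fun F hF => ?_⟩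
  by_contra hne
  obtain ⟨x, hx⟩ := FaceLattice.ne_bot_iff.1 hne
  have hxa : x = a := hF.le hx
  exact hF.not_ge (Set.singleton_subset_iff.2 (hxa ▸ hx))

theorem isExposed_stdSimplex_iff {k : ℕ} {F : Set (Fin k → ℝ)} (hF : F.Nonempty) :
    IsExposed ℝ (stdSimplex ℝ (Fin k)) F ↔ ∃ (l : StrongDual ℝ (Fin k → ℝ)) (c : ℝ),
      (∀ v ∈ Set.range fun m : Fin k => (Pi.single m 1 : Fin k → ℝ), l v ≤ c) ∧
        F = convexHull ℝ {v ∈ Set.range fun m : Fin k => (Pi.single m 1 : Fin k → ℝ) | l v = c} := by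
  rw [← convexHull_rangle_single_eq_stdSimplex]
  exact isExposed_convexHull_iff hF

theorem isExposed_stdSimplex_single {k : ℕ} (i : Fin k) :
    IsExposed ℝ (stdSimplex ℝ (Fin k)) {Pi.single i 1} := by
  rw [← convexHull_rangle_single_eq_stdSimplex]
  refine isExposed_singleton_of_strict ⟨i, rfl⟩ (l := ContinuousLinearMap.proj i) ?_
  rintro _ ⟨j, rfl⟩ hne
  have hji : i ≠ j := by
    rintro rfl
    exact hne rfl
  simp [hji]

theorem isAtom_faceLattice_stdSimplex {k : ℕ} {a : FaceLattice (stdSimplex ℝ (Fin k))}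
    (ha : IsAtom a) : ∃ i, a = ⟨{Pi.single i 1}, isExposed_stdSimplex_single i⟩ := by
  have hne := FaceLattice.ne_bot_iff.1 ha.1
  obtain ⟨l, c, -, hac⟩ := (isExposed_stdSimplex_iff hne).1 a.2
  rw [hac, convexHull_nonempty_iff] at hne
  obtain ⟨_, ⟨i, rfl⟩, hi⟩ := hne
  refine ⟨i, ((ha.le_iff_eq (FaceLattice.ne_bot_iff.2 (Set.singleton_nonempty _))).1 ?_).symm⟩
  refine Set.singleton_subset_iff.2 ?_
  rw [hac]
  exact subset_convexHull ℝ _ ⟨⟨i, rfl⟩, hi⟩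

/-- Any two vertices of a standard simplex lie in a face with no other vertices. -/
theorem exists_face_of_atoms_stdSimplex {k : ℕ} {a b : FaceLattice (stdSimplex ℝ (Fin k))}
    (ha : IsAtom a) (hb : IsAtom b) :
    ∃ e, a ≤ e ∧ b ≤ e ∧ ∀ c, IsAtom c → c ≤ e → c = a ∨ c = b := by
  rcases eq_or_ne a b with rfl | hab
  · exact ⟨a, le_rfl, le_rfl, fun c hc hca => Or.inl ((ha.le_iff_eq hc.1).1 hca)⟩
  obtain ⟨i, rfl⟩ := isAtom_faceLattice_stdSimplex ha
  obtain ⟨j, rfl⟩ := isAtom_faceLattice_stdSimplex hb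
  have hij : i ≠ j := by
    rintro rfl
    exact hab rfl
  let π : Fin k → StrongDual ℝ (Fin k → ℝ) := fun m => ContinuousLinearMap.proj m
  let l : StrongDual ℝ (Fin k → ℝ) := π i + π j
  have hl : ∀ m, l (Pi.single m 1) = if m = i ∨ m = j then 1 else 0 := fun m => by
    rcases eq_or_ne m i with rfl | hmi
    · simp [l, π, hij.symm]
    · rcases eq_or_ne m j with rfl | hmj
      · simp [l, π, hij]
      · simp [l, π, hmi, hmj, hmi.symm, hmj.symm]
  let e : Set (Fin k → ℝ) :=
    convexHull ℝ {v ∈ Set.range fun m : Fin k => (Pi.single m 1 : Fin k → ℝ) | l v = 1}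
  have hi : Pi.single i 1 ∈ e := subset_convexHull ℝ _ ⟨⟨i, rfl⟩, by simp [hl]⟩
  have hj : Pi.single j 1 ∈ e := subset_convexHull ℝ _ ⟨⟨j, rfl⟩, by simp [hl]⟩
  have he : IsExposed ℝ (stdSimplex ℝ (Fin k)) e := by
    refine (isExposed_stdSimplex_iff ⟨_, hi⟩).2 ⟨l, 1, ?_, rfl⟩
    rintro _ ⟨m, rfl⟩
    simp only [hl]
    split_ifs <;> norm_num
  refine ⟨⟨e, he⟩, Set.singleton_subset_iff.2 hi, Set.singleton_subset_iff.2 hj, fun c hc hce => ?_⟩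
  obtain ⟨m, rfl⟩ := isAtom_faceLattice_stdSimplex hc
  have hm : l (Pi.single m 1) = 1 :=
    eq_of_mem_convexHull (fun v hv => hv.2) (Set.singleton_subset_iff.1 hce)
  rw [hl] at hm
  rcases em (m = i ∨ m = j) with (rfl | rfl) | h
  · exact Or.inl rfl
  · exact Or.inr rfl
  · simp [h] at hm

theorem IsCombSimplex.exists_face {A : Set E} (hA : IsCombSimplex A) {a b : E}
    (ha : IsExposed ℝ A {a}) (hb : IsExposed ℝ A {b}) :
    ∃ e, IsExposed ℝ A e ∧ a ∈ e ∧ b ∈ e ∧ ∀ c, IsExposed ℝ A {c} → c ∈ e → c = a ∨ c = b := by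
  obtain ⟨k, ⟨φ⟩⟩ := hA
  obtain ⟨e, hae, hbe, he⟩ := exists_face_of_atoms_stdSimplex
    ((φ.isAtom_iff _).2 (isAtom_singleton ha)) ((φ.isAtom_iff _).2 (isAtom_singleton hb))
  refine ⟨(φ.symm e).1, (φ.symm e).2, ?_, ?_, fun c hc hce => ?_⟩
  · exact Set.singleton_subset_iff.1 ((φ.le_symm_apply).2 hae)
  · exact Set.singleton_subset_iff.1 ((φ.le_symm_apply).2 hbe)
  · refine (he (φ ⟨{c}, hc⟩) ((φ.isAtom_iff _).2 (isAtom_singleton hc))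
      ((φ.le_symm_apply).1 (Set.singleton_subset_iff.2 hce))).imp (fun h => ?_) fun h => ?_
    all_goals exact Set.singleton_injective (Subtype.ext_iff.1 (φ.injective h))

end CombSimplex

/-! ### Edge cuts in graphs -/

namespace SimpleGraph

variable {V : Type*} [Fintype V] [DecidableEq V]

/-- If `C` is a smallest vertex cover, Hall's condition holds for every set `A ⊆ C` of vertices
without edges inside, with partners outside `C`: a violating subset of `A` could be exchanged for
its neighbors outside `C`. -/
theorem exists_matching_of_minimal_cover (H : SimpleGraph V) [DecidableRel H.Adj] {C A : Finset V}
    (hC : H.IsVertexCover C) (hmin : ∀ C' : Finset V, H.IsVertexCover C' → C.card ≤ C'.card)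
    (hAC : A ⊆ C) (hA : ∀ u ∈ A, ∀ v ∈ A, ¬ H.Adj u v) :
    ∃ f : V → V, Set.InjOn f A ∧ ∀ a ∈ A, H.Adj a (f a) ∧ f a ∉ C := by
  let t : A → Finset V := fun a => H.neighborFinset a \ C
  obtain ⟨f, hf, hft⟩ := (Finset.all_card_le_biUnion_card_iff_exists_injective t).1 fun S => by
    let S' : Finset V := S.map (Function.Embedding.subtype _)
    have hS'A : ∀ u ∈ S', u ∈ A := fun u hu => by
      obtain ⟨a, -, rfl⟩ := Finset.mem_map.1 hu
      exact a.2
    have hcov : ∀ u v, H.Adj u v → u ∈ C → u ∈ C \ S' ∪ S.biUnion t ∨ v ∈ C \ S' ∪ S.biUnion t := by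
      intro u v huv hu
      by_cases huS : u ∈ S'
      · right
        by_cases hv : v ∈ C
        · exact Finset.mem_union_left _ (Finset.mem_sdiff.2
            ⟨hv, fun hvS => hA u (hS'A u huS) v (hS'A v hvS) huv⟩)
        · obtain ⟨a, ha, rfl⟩ := Finset.mem_map.1 huS
          exact Finset.mem_union_right _ (Finset.mem_biUnion.2
            ⟨a, ha, Finset.mem_sdiff.2 ⟨(H.mem_neighborFinset _ _).2 huv, hv⟩⟩)
      · exact Or.inl (Finset.mem_union_left _ (Finset.mem_sdiff.2 ⟨hu, huS⟩))
    have h1 := hmin (C \ S' ∪ S.biUnion t) fun u v huv => by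
      rcases hC huv with hu | hv
      · exact hcov u v huv hu
      · exact (hcov v u huv.symm hv).symm
    have h2 := Finset.card_union_le (C \ S') (S.biUnion t)
    have h3 := Finset.card_sdiff_add_card_eq_card (s := S') (t := C) fun u hu => hAC (hS'A u hu)
    have h4 : S'.card = S.card := Finset.card_map _
    omega
  refine ⟨fun v => if hv : v ∈ A then f ⟨v, hv⟩ else v, fun u hu v hv huv => ?_, fun a ha => ?_⟩
  · have hu' : u ∈ A := hu
    have hv' : v ∈ A := hv
    simp only [hu', hv', dif_pos] at huv
    exact congrArg Subtype.val (hf huv)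
  · have := Finset.mem_sdiff.1 (hft ⟨a, ha⟩)
    simp only [ha, dif_pos]
    exact ⟨(H.mem_neighborFinset _ _).1 this.1, this.2⟩

/-- A bipartite graph in which the degrees of adjacent vertices add up to at least `k`, and in which
a vertex cover has at least `m` vertices, has at least `m * k / 2` edges: by Kőnig's theorem there
are `m` disjoint edges, and their ends have total degree at least `m * k`. -/
theorem IsBipartiteWith.mul_le_two_mul_card_edgeFinset {H : SimpleGraph V} [DecidableRel H.Adj]
    {X Y : Finset V} (hH : H.IsBipartiteWith (X : Set V) Y) {m k : ℕ}
    (hk : ∀ u v, H.Adj u v → k ≤ H.degree u + H.degree v)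
    (hm : ∀ C : Finset V, H.IsVertexCover C → m ≤ C.card) :
    m * k ≤ 2 * H.edgeFinset.card := by
  obtain ⟨C, hC, hmin⟩ : ∃ C : Finset V, H.IsVertexCover C ∧
      ∀ C' : Finset V, H.IsVertexCover C' → C.card ≤ C'.card := by
    classical
    obtain ⟨C, hC, hmin⟩ := Finset.exists_min_image
      (Finset.univ.filter fun C : Finset V => H.IsVertexCover C) Finset.card
      ⟨Finset.univ, by simp⟩
    exact ⟨C, (Finset.mem_filter.1 hC).2, fun C' hC' => hmin C' (by simpa using hC')⟩
  have hXY : ∀ u ∈ X, u ∉ Y := fun u hu hv => Set.disjoint_left.1 hH.disjoint hu hv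
  have hside : ∀ u v, H.Adj u v → (u ∈ X ↔ v ∉ X) := fun u v huv => by
    have := hH.mem_of_adj huv
    simp only [Finset.mem_coe] at this
    have := hXY u
    have := hXY v
    tauto
  obtain ⟨f, hfi, hf⟩ := exists_matching_of_minimal_cover H hC hmin
    (A := C.filter (· ∈ X)) (Finset.filter_subset _ _) fun u hu v hv huv =>
      (hside u v huv).1 (Finset.mem_filter.1 hu).2 (Finset.mem_filter.1 hv).2
  obtain ⟨g, hgi, hg⟩ := exists_matching_of_minimal_cover H hC hmin
    (A := C.filter (· ∉ X)) (Finset.filter_subset _ _) fun u hu v hv huv =>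
      (Finset.mem_filter.1 hu).2 ((hside u v huv).2 (Finset.mem_filter.1 hv).2)
  let p : V → V := fun c => if c ∈ X then f c else g c
  have hp : ∀ c ∈ C, H.Adj c (p c) ∧ p c ∉ C := fun c hc => by
    by_cases hcX : c ∈ X
    · simp only [p, hcX, if_true]
      exact hf c (Finset.mem_filter.2 ⟨hc, hcX⟩)
    · simp only [p, hcX, if_false]
      exact hg c (Finset.mem_filter.2 ⟨hc, hcX⟩)
  have hpi : Set.InjOn p C := fun a ha b hb hab => by
    have h1 := hside _ _ (hp a ha).1
    have h2 := hside _ _ (hp b hb).1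
    rw [hab] at h1
    by_cases haX : a ∈ X
    · have hbX : b ∈ X := by tauto
      simp only [p, haX, hbX, if_true] at hab
      exact hfi (Finset.mem_coe.2 (Finset.mem_filter.2 ⟨ha, haX⟩))
        (Finset.mem_coe.2 (Finset.mem_filter.2 ⟨hb, hbX⟩)) hab
    · have hbX : b ∉ X := by tauto
      simp only [p, haX, hbX, if_false] at hab
      exact hgi (Finset.mem_coe.2 (Finset.mem_filter.2 ⟨ha, haX⟩))
        (Finset.mem_coe.2 (Finset.mem_filter.2 ⟨hb, hbX⟩)) hab
  have hdisj : Disjoint C (C.image p) := Finset.disjoint_left.2 fun c hc hc' => by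
    obtain ⟨a, ha, rfl⟩ := Finset.mem_image.1 hc'
    exact (hp a ha).2 hc
  calc m * k ≤ C.card * k := Nat.mul_le_mul_right k (hm C hC)
    _ = ∑ _c ∈ C, k := by rw [Finset.sum_const, smul_eq_mul]
    _ ≤ ∑ c ∈ C, (H.degree c + H.degree (p c)) := Finset.sum_le_sum fun c hc => hk _ _ (hp c hc).1
    _ = ∑ v ∈ C ∪ C.image p, H.degree v := by
        rw [Finset.sum_union hdisj, Finset.sum_image hpi, Finset.sum_add_distrib]
    _ ≤ ∑ v, H.degree v := Finset.sum_le_sum_of_subset (Finset.subset_univ _)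
    _ = 2 * H.edgeFinset.card := H.sum_degrees_eq_twice_card_edges

/-- The graph of the edges of `G` between `X` and its complement. -/
def cutGraph (G : SimpleGraph V) (X : Finset V) : SimpleGraph V where
  Adj u v := G.Adj u v ∧ (u ∈ X ↔ v ∉ X)
  symm := ⟨fun u v h => ⟨h.1.symm, by have := h.2; tauto⟩⟩
  loopless := ⟨fun u h => G.loopless.irrefl u h.1⟩

instance (G : SimpleGraph V) [DecidableRel G.Adj] (X : Finset V) :
    DecidableRel (G.cutGraph X).Adj :=
  fun u v => inferInstanceAs (Decidable (G.Adj u v ∧ (u ∈ X ↔ v ∉ X)))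

theorem cutGraph_compl (G : SimpleGraph V) (X : Finset V) : G.cutGraph Xᶜ = G.cutGraph X := by
  ext u v
  simp only [cutGraph, Finset.mem_compl]
  tauto

theorem isBipartiteWith_cutGraph (G : SimpleGraph V) (X : Finset V) :
    (G.cutGraph X).IsBipartiteWith (X : Set V) (Xᶜ : Finset V) where
  disjoint := Finset.disjoint_coe.2 disjoint_compl_right
  mem_of_adj u v h := by
    have := h.2
    simp only [Finset.coe_compl, Set.mem_compl_iff, Finset.mem_coe]
    tauto

variable (G : SimpleGraph V) [DecidableRel G.Adj]

theorem card_edgeFinset_cutGraph_compl (X : Finset V) :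
    (G.cutGraph Xᶜ).edgeFinset.card = (G.cutGraph X).edgeFinset.card := by
  congr 1
  rw [← Finset.coe_inj, coe_edgeFinset, coe_edgeFinset, cutGraph_compl]

/-- A nonempty vertex set with at most `minDegree` elements has at least `minDegree` edges leaving
it, since each of its vertices has few neighbors inside. -/
theorem minDegree_le_card_cutGraph {X : Finset V} (hX : X.Nonempty) (hcard : X.card ≤ G.minDegree) :
    G.minDegree ≤ (G.cutGraph X).edgeFinset.card := by
  have hdeg : ∀ x ∈ X, G.minDegree + 1 ≤ (G.cutGraph X).degree x + X.card := fun x hx => by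
    have h1 := G.minDegree_le_degree x
    have h2 : G.neighborFinset x ⊆ (G.cutGraph X).neighborFinset x ∪ X.erase x := fun y hy => by
      have hxy := (G.mem_neighborFinset _ _).1 hy
      rw [Finset.mem_union, mem_neighborFinset, Finset.mem_erase]
      by_cases hyX : y ∈ X
      · exact Or.inr ⟨hxy.ne', hyX⟩
      · exact Or.inl ⟨hxy, by tauto⟩
    have h3 := (Finset.card_le_card h2).trans (Finset.card_union_le _ _)
    rw [card_neighborFinset_eq_degree, card_neighborFinset_eq_degree, Finset.card_erase_of_mem hx]
      at h3
    have := Finset.card_pos.2 hX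
    omega
  rw [← isBipartiteWith_sum_degrees_eq_card_edges (G.isBipartiteWith_cutGraph X)]
  have h := Finset.card_nsmul_le_sum X (fun x => (G.cutGraph X).degree x)
    (G.minDegree + 1 - X.card) fun x hx => by
      have := hdeg x hx
      omega
  refine le_trans ?_ h
  rw [smul_eq_mul]
  have hpos := Finset.card_pos.2 hX
  -- `k (δ + 1 - k) ≥ δ` for `1 ≤ k ≤ δ`
  obtain ⟨j, hj⟩ := Nat.exists_eq_add_of_le hcard
  have : G.minDegree + 1 - X.card = j + 1 := by omega
  rw [this, hj]
  nlinarith [Nat.zero_le (j * (X.card - 1)), Nat.mul_le_mul_right j (Nat.succ_le_of_lt hpos)]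

/-- Every common neighbor of the ends of a cut edge is the end of a further cut edge at one of the
two ends. -/
theorem card_inter_add_two_le_degree_cutGraph (X : Finset V) {u v : V}
    (huv : (G.cutGraph X).Adj u v) :
    (G.neighborFinset u ∩ G.neighborFinset v).card + 2 ≤
      (G.cutGraph X).degree u + (G.cutGraph X).degree v := by
  have hsub : G.neighborFinset u ∩ G.neighborFinset v ⊆
      ((G.cutGraph X).neighborFinset u).erase v ∪ ((G.cutGraph X).neighborFinset v).erase u := by
    intro z hz
    rw [Finset.mem_inter, mem_neighborFinset, mem_neighborFinset] at hz
    rw [Finset.mem_union, Finset.mem_erase, Finset.mem_erase, mem_neighborFinset, mem_neighborFinset]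
    have h1 := huv.2
    by_cases hzu : (u ∈ X ↔ z ∉ X)
    · exact Or.inl ⟨hz.2.ne', hz.1, hzu⟩
    · exact Or.inr ⟨hz.1.ne', hz.2, by tauto⟩
  have h := (Finset.card_le_card hsub).trans (Finset.card_union_le _ _)
  rw [Finset.card_erase_of_mem ((mem_neighborFinset _ _ _).2 huv),
    Finset.card_erase_of_mem ((mem_neighborFinset _ _ _).2 huv.symm),
    card_neighborFinset_eq_degree, card_neighborFinset_eq_degree] at h
  have h1 : 0 < (G.cutGraph X).degree u := ((G.cutGraph X).degree_pos_iff_exists_adj u).2 ⟨v, huv⟩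
  have h2 : 0 < (G.cutGraph X).degree v :=
    ((G.cutGraph X).degree_pos_iff_exists_adj v).2 ⟨u, huv.symm⟩
  omega

/-- The graph-theoretic core: a `d`-connected graph in which adjacent vertices have at least `d - 1`
common neighbors. Connectivity is expressed by two-colorings of the vertices. -/
theorem isEdgeConnected_of_common_neighbors {d : ℕ} (hdeg : ∀ v, d ≤ G.degree v)
    (hcommon : ∀ u v, G.Adj u v → d ≤ (G.neighborFinset u ∩ G.neighborFinset v).card + 1)
    (hconn : ∀ (C : Finset V) (φ : V → Prop), C.card < d →
      (∀ p q, p ∉ C → q ∉ C → G.Adj p q → (φ p ↔ φ q)) → ∀ a b, a ∉ C → b ∉ C → (φ a ↔ φ b)) :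
    G.IsEdgeConnected (min G.minDegree (4 * d - 6)) := by
  classical
  intro u v s hs
  by_contra hreach
  let X : Finset V := Finset.univ.filter fun w => (G.deleteEdges s).Reachable u w
  have huX : u ∈ X := by simp [X]
  have hvX : v ∈ Xᶜ := by simpa [X] using hreach
  have hedges : ((G.cutGraph X).edgeFinset : Set (Sym2 V)) ⊆ s := by
    intro e
    induction e using Sym2.ind with
    | _ a b =>
    rw [coe_edgeFinset, mem_edgeSet]
    rintro ⟨hab, hX⟩
    by_contra hes
    have hadj : (G.deleteEdges s).Adj a b := by simp [deleteEdges_adj, hab, hes]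
    simp only [X, Finset.mem_filter, Finset.mem_univ, true_and] at hX
    have h1 : (G.deleteEdges s).Reachable u a → (G.deleteEdges s).Reachable u b :=
      fun h => h.trans hadj.reachable
    have h2 : (G.deleteEdges s).Reachable u b → (G.deleteEdges s).Reachable u a :=
      fun h => h.trans hadj.symm.reachable
    tauto
  have hlt : (G.cutGraph X).edgeFinset.card < min G.minDegree (4 * d - 6) := by
    have := (Set.encard_le_encard hedges).trans_lt hs
    rw [Set.encard_coe_eq_coe_finsetCard] at this
    exact_mod_cast this
  have hd : d ≤ G.minDegree := by
    have : Nonempty V := ⟨u⟩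
    exact G.le_minDegree_of_forall_le_degree d hdeg
  have hXcard : d < X.card := by
    by_contra! h
    have := G.minDegree_le_card_cutGraph ⟨u, huX⟩ (h.trans hd)
    omega
  have hXcard' : d < Xᶜ.card := by
    by_contra! h
    have := G.minDegree_le_card_cutGraph ⟨v, hvX⟩ (h.trans hd)
    rw [card_edgeFinset_cutGraph_compl] at this
    omega
  have hcover : ∀ C : Finset V, (G.cutGraph X).IsVertexCover C → d ≤ C.card := by
    intro C hC
    by_contra! hCd
    obtain ⟨a, haX, haC⟩ := Finset.exists_mem_notMem_of_card_lt_card (hCd.trans hXcard)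
    obtain ⟨b, hbX, hbC⟩ := Finset.exists_mem_notMem_of_card_lt_card (hCd.trans hXcard')
    refine Finset.mem_compl.1 hbX ((hconn C (· ∈ X) hCd (fun p q hp hq hpq => ?_) a b haC hbC).1 haX)
    by_contra hX
    have hpq' : (G.cutGraph X).Adj p q := ⟨hpq, by tauto⟩
    exact (hC hpq').elim hp hq
  have hfinal := (G.isBipartiteWith_cutGraph X).mul_le_two_mul_card_edgeFinset (k := d + 1)
    (fun p q hpq => by
      have h1 := G.card_inter_add_two_le_degree_cutGraph X hpq
      have h2 := hcommon p q hpq.1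
      omega) hcover
  have hlt' : (G.cutGraph X).edgeFinset.card + 7 ≤ 4 * d := by omega
  -- `d (d + 1) - 2 (4 d - 6) = (d - 3) (d - 4) ≥ 0` for every natural number `d`.
  rcases Nat.lt_or_ge d 4 with h | h
  · interval_cases d <;> omega
  · obtain ⟨j, rfl⟩ := Nat.exists_eq_add_of_le h
    nlinarith

end SimpleGraph

/-! ### The graph of a polytope -/

namespace ConvexPolytope

variable {n : ℕ} (P : ConvexPolytope n)

/-- The set of vertices of a polytope, as points of the ambient space. -/
def vertexSet : Set (EuclideanSpace ℝ (Fin n)) := {v | IsExposed ℝ P.carrier {v}}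

theorem finite_vertexSet : P.vertexSet.Finite :=
  Set.finite_coe_iff.1 P.finite_vertex

theorem convexHull_vertexSet : convexHull ℝ P.vertexSet = P.carrier := by
  obtain ⟨s, hs, hP⟩ := P.exists_finite_hull
  have h : P.vertexSet = (convexHull ℝ s).exposedPoints ℝ := by
    ext v
    rw [mem_exposedPoints_iff_exposed_singleton, ← hP]
    rfl
  rw [h, convexHull_exposedPoints_convexHull hs, hP]

theorem isExposed_iff {F : Set (EuclideanSpace ℝ (Fin n))} (hF : F.Nonempty) :
    IsExposed ℝ P.carrier F ↔ ∃ (l : StrongDual ℝ (EuclideanSpace ℝ (Fin n))) (c : ℝ),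
      (∀ v ∈ P.vertexSet, l v ≤ c) ∧ F = convexHull ℝ {v ∈ P.vertexSet | l v = c} := by
  conv_lhs => rw [← P.convexHull_vertexSet]
  exact isExposed_convexHull_iff hF

variable {P}

theorem finrank_vectorSpan_vertexSet {d : ℕ} (hdim : P.dim = d) :
    Module.finrank ℝ (vectorSpan ℝ P.vertexSet) = d := by
  rw [← vectorSpan_convexHull, P.convexHull_vertexSet]
  unfold dim affineDim at hdim
  split_ifs at hdim
  exact_mod_cast hdim

/-- Every vertex is the unique maximizer of some functional. -/
theorem exists_strict (v : P.Vertex) :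
    ∃ l : StrongDual ℝ (EuclideanSpace ℝ (Fin n)), ∀ w : P.Vertex, w ≠ v → l w.1 < l v.1 := by
  obtain ⟨l, hl⟩ := exists_strict_of_isExposed_singleton v.2
  exact ⟨l, fun w hw => hl w.1 (w.2.subset rfl) fun h => hw (Subtype.ext h)⟩

theorem exists_increasing_neighbor (f : StrongDual ℝ (EuclideanSpace ℝ (Fin n))) {v w : P.Vertex}
    (h : f v.1 < f w.1) : ∃ u, P.graph.Adj v u ∧ f v.1 < f u.1 := by
  obtain ⟨l, hl⟩ := exists_strict v
  obtain ⟨u, hu, huv, hfu, hexp⟩ := exists_increasing_edge P.finite_vertexSet (v := v.1) v.2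
    (fun x hx hxv => hl ⟨x, hx⟩ fun h => hxv (congrArg Subtype.val h)) f w.2 h
  rw [P.convexHull_vertexSet] at hexp
  exact ⟨⟨u, hu⟩, ⟨fun h => huv (congrArg Subtype.val h).symm, hexp⟩, hfu⟩

/-! ### Balinski's theorem -/

/-- In the part of the graph strictly above a hyperplane, every vertex is connected by an increasing
path to the same vertex `t`. For the path to be steered to a single `t` in the top face of `f`, it
increases along a perturbation of `f` that only `t` maximizes. -/
theorem coloring_const_of_lt (f : StrongDual ℝ (EuclideanSpace ℝ (Fin n))) (c : ℝ)
    {φ : P.Vertex → Prop}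
    (hφ : ∀ p q, c < f p.1 → c < f q.1 → P.graph.Adj p q → (φ p ↔ φ q)) {a b : P.Vertex}
    (ha : c < f a.1) (hb : c < f b.1) : φ a ↔ φ b := by
  classical
  obtain ⟨t, -, ht⟩ := Finset.exists_max_image Finset.univ (fun v : P.Vertex => f v.1)
    ⟨a, Finset.mem_univ a⟩
  obtain ⟨l, hl⟩ := exists_strict t
  obtain ⟨ε, hε, hlex⟩ := exists_perturbation P.finite_vertexSet f l
  suffices h : ∀ u : P.Vertex, c < f u.1 → (φ u ↔ φ t) from (h a ha).trans (h b hb).symm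
  by_contra! hcon
  obtain ⟨u₀, hu₀, hu₀t⟩ := hcon
  obtain ⟨u, hu, hmax⟩ := Finset.exists_max_image
    (Finset.univ.filter fun u : P.Vertex => c < f u.1 ∧ ¬ (φ u ↔ φ t))
    (fun u => (f + ε • l) u.1) ⟨u₀, by
      simp only [Finset.mem_filter, Finset.mem_univ, true_and]
      exact ⟨hu₀, by tauto⟩⟩
  simp only [Finset.mem_filter, Finset.mem_univ, true_and] at hu hmax
  have hut : u ≠ t := by
    rintro rfl
    exact hu.2 Iff.rfl
  have hlt : (f + ε • l) u.1 < (f + ε • l) t.1 := by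
    rcases (ht u (Finset.mem_univ u)).lt_or_eq with h | h
    · exact hlex u.1 u.2 t.1 t.2 h
    · have := mul_lt_mul_of_pos_left (hl u hut) hε
      simpa [h] using this
  obtain ⟨w, huw, hw⟩ := exists_increasing_neighbor _ hlt
  have hfw : f u.1 ≤ f w.1 := by
    by_contra! h
    exact (hlex w.1 w.2 u.1 u.2 h).not_gt hw
  have hcw : c < f w.1 := hu.1.trans_le hfw
  have hwt : φ w ↔ φ t := by
    by_contra h
    exact (hmax w ⟨hcw, h⟩).not_gt hw
  exact hu.2 ((hφ u w hu.1 hcw huw).trans hwt)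

/-- The same on the closed side of the hyperplane when the vertices `C` on it are removed: each
remaining vertex on the hyperplane has a neighbor strictly above it. -/
theorem coloring_const_of_le (f : StrongDual ℝ (EuclideanSpace ℝ (Fin n))) {C : Finset P.Vertex}
    {c : ℝ} (hC : ∀ p ∈ C, f p.1 = c) {w₀ : P.Vertex} (hw₀ : c < f w₀.1) {φ : P.Vertex → Prop}
    (hφ : ∀ p q, p ∉ C → q ∉ C → P.graph.Adj p q → (φ p ↔ φ q)) {a b : P.Vertex}
    (haC : a ∉ C) (hbC : b ∉ C) (ha : c ≤ f a.1) (hb : c ≤ f b.1) : φ a ↔ φ b := by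
  have hnot : ∀ p : P.Vertex, c < f p.1 → p ∉ C := fun p hp hpC => hp.ne' (hC p hpC)
  have key : ∀ u : P.Vertex, u ∉ C → c ≤ f u.1 → (φ u ↔ φ w₀) := fun u huC hu => by
    have hgt := fun p q hp hq => hφ p q (hnot p hp) (hnot q hq)
    rcases hu.lt_or_eq with h | h
    · exact coloring_const_of_lt f c hgt h hw₀
    · obtain ⟨w, huw, hw⟩ := exists_increasing_neighbor f (h ▸ hw₀ : f u.1 < f w₀.1)
      rw [← h] at hw
      exact (hφ u w huC (hnot w hw) huw).trans (coloring_const_of_lt f c hgt hw hw₀)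
  exact (key a haC ha).trans (key b hbC hb).symm

/-- **Balinski's theorem**: the graph of a `d`-polytope stays connected after the removal of fewer
than `d` vertices. A hyperplane containing the removed vertices and one remaining vertex `a` splits
the graph into two connected parts that share `a`. -/
theorem balinski {d : ℕ} (hdim : P.dim = d) (C : Finset P.Vertex) (φ : P.Vertex → Prop)
    (hC : C.card < d) (hφ : ∀ p q, p ∉ C → q ∉ C → P.graph.Adj p q → (φ p ↔ φ q))
    (a b : P.Vertex) (ha : a ∉ C) (hb : b ∉ C) : φ a ↔ φ b := by
  classical
  let A : Set (EuclideanSpace ℝ (Fin n)) := ((insert a C).image Subtype.val : Finset _)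
  have hmemA : ∀ p ∈ insert a C, p.1 ∈ A := fun p hp =>
    Finset.mem_coe.2 (Finset.mem_image_of_mem _ hp)
  have hA : Module.finrank ℝ (vectorSpan ℝ A) <
      Module.finrank ℝ (vectorSpan ℝ P.vertexSet) := by
    rw [finrank_vectorSpan_vertexSet hdim]
    exact (finrank_vectorSpan_image_finset_le ℝ _ _ (Finset.card_insert_of_notMem ha)).trans_lt hC
  obtain ⟨w, hwV, hwA⟩ : ∃ w ∈ vectorSpan ℝ P.vertexSet, w ∉ vectorSpan ℝ A := by
    by_contra! h
    exact hA.not_ge (Submodule.finrank_mono h)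
  obtain ⟨f, hfA, hfw⟩ := exists_dual_of_notMem hwA
  have hfC : ∀ p ∈ C, f p.1 = f a.1 := fun p hp =>
    (vectorSpan_le_ker_iff (hmemA a (Finset.mem_insert_self a C)) f).1 hfA p.1
      (hmemA p (Finset.mem_insert_of_mem hp))
  have hnonconst : ∃ v : P.Vertex, f v.1 ≠ f a.1 := by
    by_contra! h
    exact hfw ((vectorSpan_le_ker_iff (V := P.vertexSet) a.2 f).2 (fun v hv => h ⟨v, hv⟩) hwV)
  have hup : ∀ v : P.Vertex, f a.1 < f v.1 → f a.1 ≤ f b.1 → (φ a ↔ φ b) := fun v hv h =>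
    coloring_const_of_le f hfC hv hφ ha hb le_rfl h
  have hdown : ∀ v : P.Vertex, f v.1 < f a.1 → f b.1 ≤ f a.1 → (φ a ↔ φ b) := fun v hv h =>
    coloring_const_of_le (-f) (c := -f a.1) (fun p hp => by simp [hfC p hp])
      (by simpa using hv) hφ ha hb (by simp) (by simpa using h)
  obtain ⟨v, hv⟩ := hnonconst
  rcases lt_trichotomy (f a.1) (f b.1) with h | h | h
  · exact hup b h h.le
  · rcases hv.lt_or_gt with h' | h'
    · exact hdown v h' h.ge
    · exact hup v h' h.le
  · exact hdown b h h.le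

/-! ### Common neighbors in simplicial polytopes -/

/-- Two vertices of a face that is a simplex are adjacent. -/
theorem adj_of_mem_combSimplex {F : Set (EuclideanSpace ℝ (Fin n))}
    (hF : IsExposed ℝ P.carrier F) (hs : IsCombSimplex F) {a b : P.Vertex} (ha : a.1 ∈ F)
    (hb : b.1 ∈ F) (hab : a ≠ b) : P.graph.Adj a b := by
  have hsing : ∀ v : P.Vertex, v.1 ∈ F → IsExposed ℝ F {v.1} := fun v hv =>
    v.2.mono hF.subset (Set.singleton_subset_iff.2 hv)
  obtain ⟨e, he, hae, hbe, hatoms⟩ := hs.exists_face (hsing a ha) (hsing b hb)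
  have heP : IsExposed ℝ (convexHull ℝ P.vertexSet) e :=
    IsExposed.trans_convexHull P.finite_vertexSet (P.convexHull_vertexSet.symm ▸ hF) he
  obtain ⟨l, c, -, hec⟩ := (isExposed_convexHull_iff ⟨a.1, hae⟩).1 heP
  have hseg : e = segment ℝ a.1 b.1 := by
    refine Set.Subset.antisymm ?_ ((heP.convex (convex_convexHull ℝ _)).segment_subset hae hbe)
    rw [← convexHull_pair, hec]
    refine convexHull_mono fun v hv => ?_
    have hve : v ∈ e := hec ▸ subset_convexHull ℝ _ hv
    exact hatoms v (hsing ⟨v, hv.1⟩ (he.subset hve)) hve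
  refine ⟨hab, ?_⟩
  rw [← hseg, ← P.convexHull_vertexSet]
  exact heP

theorem finrank_vectorSpan_lt_card {S : Finset P.Vertex} (hS : S.Nonempty) :
    Module.finrank ℝ (vectorSpan ℝ (Subtype.val '' (S : Set P.Vertex))) < S.card := by
  classical
  obtain ⟨m, hm⟩ := Nat.exists_eq_succ_of_ne_zero (Finset.card_pos.2 hS).ne'
  have := finrank_vectorSpan_image_finset_le ℝ (Subtype.val : P.Vertex → _) S hm
  rw [Finset.coe_image] at this
  omega

theorem lt_card_vertex {d : ℕ} (hdim : P.dim = d) (hd : 0 < d) : d < Fintype.card P.Vertex := by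
  classical
  have hne : (Finset.univ : Finset P.Vertex).Nonempty := by
    by_contra h
    rw [Finset.univ_nonempty_iff, not_nonempty_iff] at h
    have h0 : P.vertexSet = ∅ := Set.isEmpty_coe_sort.1 h
    have := finrank_vectorSpan_vertexSet hdim
    rw [h0, vectorSpan_empty, finrank_bot] at this
    omega
  have := finrank_vectorSpan_lt_card hne
  rw [Finset.coe_univ, Set.image_univ, Finset.card_univ] at this
  have hrange : Set.range (Subtype.val : P.Vertex → _) = P.vertexSet := Subtype.range_coe
  rwa [hrange, finrank_vectorSpan_vertexSet hdim] at this

/-- Every edge that misses a vertex `z` is contained in a facet that misses `z`, whose vertices are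
at least `d` pairwise adjacent vertices. -/
theorem exists_clique_avoiding {d : ℕ} (hdim : P.dim = d) (hP : P.IsSimplicial) {x y z : P.Vertex}
    (hxy : P.graph.Adj x y) (hzx : z ≠ x) (hzy : z ≠ y) :
    ∃ S : Finset P.Vertex, d ≤ S.card ∧ x ∈ S ∧ y ∈ S ∧ z ∉ S ∧
      ∀ a ∈ S, ∀ b ∈ S, a ≠ b → P.graph.Adj a b := by
  classical
  obtain ⟨l₀, c, hc, hseg⟩ := (P.isExposed_iff ⟨x.1, left_mem_segment ℝ x.1 y.1⟩).1 hxy.2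
  have hval : ∀ p ∈ segment ℝ x.1 y.1, l₀ p = c := fun p hp =>
    eq_of_mem_convexHull (fun v hv => hv.2) (hseg ▸ hp)
  have hx := hval x.1 (left_mem_segment ℝ _ _)
  have hy := hval y.1 (right_mem_segment ℝ _ _)
  have hz : l₀ z.1 < l₀ x.1 := by
    rw [hx]
    refine lt_of_le_of_ne (hc z.1 z.2) fun h => ?_
    have hzseg : z.1 ∈ convexHull ℝ {x.1, y.1} := by
      rw [convexHull_pair, hseg]
      exact subset_convexHull ℝ _ ⟨z.2, h⟩
    obtain ⟨l, hl⟩ := exists_strict z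
    have := le_of_mem_convexHull (l := l) (c := max (l x.1) (l y.1)) (by simp) hzseg
    exact this.not_gt (max_lt (hl x hzx.symm) (hl y hzy.symm))
  obtain ⟨l, hl, hface, hlz, hrank⟩ := exists_facet_avoiding P.finite_vertexSet x.2 z.2
    (fun v hv => (hc v hv).trans_eq hx.symm) hz
  rw [finrank_vectorSpan_vertexSet hdim] at hrank
  let T : Set (EuclideanSpace ℝ (Fin n)) := {v ∈ P.vertexSet | l v = l x.1}
  have hTne : (convexHull ℝ T).Nonempty := ⟨x.1, subset_convexHull ℝ _ ⟨x.2, rfl⟩⟩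
  have hF : IsExposed ℝ P.carrier (convexHull ℝ T) := (P.isExposed_iff hTne).2 ⟨l, l x.1, hl, rfl⟩
  have hfacet : P.IsFacet (convexHull ℝ T) := by
    refine ⟨hF, ?_⟩
    rw [hdim, affineDim, if_pos hTne, vectorSpan_convexHull]
    change Module.finrank ℝ (vectorSpan ℝ T) + 1 = d at hrank
    omega
  let S : Finset P.Vertex := Finset.univ.filter fun v => l v.1 = l x.1
  have hS : ∀ v, v ∈ S ↔ l v.1 = l x.1 := fun v => by simp [S]
  have hST : Subtype.val '' (S : Set P.Vertex) = T := by
    ext v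
    constructor
    · rintro ⟨v, hv, rfl⟩
      exact ⟨v.2, (hS v).1 hv⟩
    · rintro ⟨hv, hvl⟩
      exact ⟨⟨v, hv⟩, (hS _).2 hvl, rfl⟩
  have hmem : ∀ v ∈ S, v.1 ∈ convexHull ℝ T := fun v hv =>
    subset_convexHull ℝ _ ⟨v.2, (hS v).1 hv⟩
  refine ⟨S, ?_, (hS x).2 rfl, (hS y).2 (hface y.1 y.2 (hy.trans hx.symm)),
    fun h => hlz.ne ((hS z).1 h), fun a ha b hb hab =>
      adj_of_mem_combSimplex hF (hP _ hfacet) (hmem a ha) (hmem b hb) hab⟩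
  have := finrank_vectorSpan_lt_card (S := S) ⟨x, (hS x).2 rfl⟩
  rw [hST] at this
  change Module.finrank ℝ (vectorSpan ℝ T) + 1 = d at hrank
  omega

/-- The ends of an edge of a simplicial `d`-polytope have at least `d - 1` common neighbors: a facet
containing the edge has a further vertex `z`, and a facet that contains the edge but not `z` has
`d - 2` further vertices. -/
theorem le_card_common_neighbors [DecidableEq P.Vertex] [DecidableRel P.graph.Adj] {d : ℕ}
    (hd : 3 ≤ d) (hdim : P.dim = d) (hP : P.IsSimplicial) {x y : P.Vertex}
    (hxy : P.graph.Adj x y) :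
    d ≤ (P.graph.neighborFinset x ∩ P.graph.neighborFinset y).card + 1 := by
  have hpair : ({x, y} : Finset P.Vertex).card = 2 := Finset.card_pair hxy.1
  obtain ⟨z₀, -, hz₀⟩ := Finset.exists_mem_notMem_of_card_lt_card
    (s := {x, y}) (t := (Finset.univ : Finset P.Vertex)) (by
      have := lt_card_vertex hdim (by omega)
      rw [hpair, Finset.card_univ]
      omega)
  simp only [Finset.mem_insert, Finset.mem_singleton, not_or] at hz₀
  obtain ⟨S, hS, hxS, hyS, -, hadj⟩ := exists_clique_avoiding hdim hP hxy hz₀.1 hz₀.2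
  obtain ⟨z, hzS, hz⟩ := Finset.exists_mem_notMem_of_card_lt_card (s := {x, y}) (t := S) (by omega)
  simp only [Finset.mem_insert, Finset.mem_singleton, not_or] at hz
  obtain ⟨S', hS', hxS', hyS', hzS', hadj'⟩ := exists_clique_avoiding hdim hP hxy hz.1 hz.2
  have hsub : insert z (S' \ {x, y}) ⊆ P.graph.neighborFinset x ∩ P.graph.neighborFinset y := by
    intro w hw
    rw [Finset.mem_inter, SimpleGraph.mem_neighborFinset, SimpleGraph.mem_neighborFinset]
    rcases Finset.mem_insert.1 hw with rfl | hw
    · exact ⟨hadj x hxS w hzS (Ne.symm hz.1), hadj y hyS w hzS (Ne.symm hz.2)⟩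
    · simp only [Finset.mem_sdiff, Finset.mem_insert, Finset.mem_singleton, not_or] at hw
      exact ⟨hadj' x hxS' w hw.1 (Ne.symm hw.2.1), hadj' y hyS' w hw.1 (Ne.symm hw.2.2)⟩
  have h := Finset.card_le_card hsub
  rw [Finset.card_insert_of_notMem fun h => hzS' (Finset.mem_sdiff.1 h).1] at h
  have := Finset.le_card_sdiff {x, y} S'
  omega

theorem le_degree [DecidableEq P.Vertex] [DecidableRel P.graph.Adj] {d : ℕ}
    (hd : 3 ≤ d) (hdim : P.dim = d) (hP : P.IsSimplicial) (v : P.Vertex) :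
    d ≤ P.graph.degree v := by
  have hcard := lt_card_vertex hdim (by omega)
  obtain ⟨u, hu⟩ := Fintype.exists_ne_of_one_lt_card (by omega : 1 < Fintype.card P.Vertex) v
  obtain ⟨l, hl⟩ := exists_strict u
  obtain ⟨w, hvw, -⟩ := exists_increasing_neighbor l (hl v hu.symm)
  have hsub : insert w (P.graph.neighborFinset v ∩ P.graph.neighborFinset w) ⊆
      P.graph.neighborFinset v :=
    Finset.insert_subset ((P.graph.mem_neighborFinset _ _).2 hvw) Finset.inter_subset_left
  have h := Finset.card_le_card hsub
  rw [Finset.card_insert_of_notMem (by simp), SimpleGraph.card_neighborFinset_eq_degree] at h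
  exact (le_card_common_neighbors hd hdim hP hvw).trans h

end ConvexPolytope

theorem mainTheorem2 (d : ℕ) (hd : 3 ≤ d) (n : ℕ) (P : ConvexPolytope n)
    (hdim : P.dim = (d : ℤ)) (hP : P.IsSimplicial) :
    P.graph.IsEdgeConnected (min P.minDegree (4 * d - 6)) := by
  classical
  have h := P.graph.isEdgeConnected_of_common_neighbors (d := d)
    (ConvexPolytope.le_degree hd hdim hP)
    (fun _ _ => ConvexPolytope.le_card_common_neighbors hd hdim hP)
    (ConvexPolytope.balinski hdim)
  unfold ConvexPolytope.minDegree
  convert h
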